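/- **Setting.** Spaces and products are taken in compactly generated spaces. Let $K$ be an abstract simplicial complex on $[m]=\{1,\dots,m\}$ (the empty simplex belongs to $K$), and let $(\underline X,\underline A)=\{(X_i,A_i,x_i)\}_{i\in[m]}$ be a family of based CW pairs: $X_i$ is a CW complex, $A_i\subseteq X_i$ a subcomplex and $x_i\in A_i$. For $I\subseteq[m]$ let $\widehat X^I=\bigwedge_{i\in I}X_i$ be the quotient of $X^I=\prod_{i\in I}X_i$ by the subspace of points having some coordinate equal to the base point, and let $$\widehat Z(K_I)=\bigcup_{\sigma\in K}\widehat Y^I(\sigma\cap I)\subseteq\widehat X^I,\qquad \widehat Y^I(\sigma\cap I)=\bigwedge_{i\in I}Y_i,\quad Y_i=X_i\ (i\in\sigma\cap I),\quad Y_i=A_i\ (i\in I\setminus\sigma).$$ For $J,L\subseteq[m]$ and $I=J\cup L$, the partial diagonal $$\widehat\Delta^{J,L}_I:\widehat Z(K_I)\to\widehat Z(K_J)\wedge\widehat Z(K_L),\qquad [(y_i)_{i\in I}]\mapsto[(y_j)_{j\in J}]\wedge[(y_l)_{l\in L}],$$ is the pointed map which applies the reduced diagonal to each factor with index in $J\cap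 L$ and then shuffles the factors. For a commutative ring $R$ and reduced singular cohomology classes $u\in\widetilde H^p(\widehat Z(K_J);R)$, $v\in\widetilde H^q(\widehat Z(K_L);R)$, put $u*v=(\widehat\Delta^{J,L}_I)^*(u\otimes v)\in H^{p+q}(\widehat Z(K_I);R)$, where $u\otimes v$ is the reduced class on $\widehat Z(K_J)\wedge\widehat Z(K_L)$ whose pullback to $\widehat Z(K_J)\times\widehat Z(K_L)$ is the cross product $\mathrm{pr}_1^*u\smile \mathrm{pr}_2^*v$. The family $(\underline X,\underline A)$ is a *suspension pair* if for each $i$ there is a pointed map $f_i:V_i\to U_i$ of pointed spaces such that $(X_i,A_i)=(\Sigma U_i,\Sigma V_i)$ (reduced suspensions, up to pointed homeomorphism), the inclusion $A_i\subseteq X_i$ being $\Sigma f_i$. **Theorem 1.5.** Suppose $(\underline X,\underline A)$ is a suspension pair and $J\cap L\neq\varnothing$, and let $I=J\cup L$. Then the partial diagonal $$\widehat\Delta^{J,L}_I:\widehat Z(K_I)\to\widehat Z(K_J)\wedge\widehat Z(K_L)$$ is null-homotopic, by a homotopy preserving base points. Consequently, for every commutative ring $R$ it induces the zero map on reduced singular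 cohomology with coefficients in $R$, and $u*v=0$ for all $p,q$, all $u\in\widetilde H^p(\widehat Z(K_J);R)$ and all $v\in\widetilde H^q(\widehat Z(K_L);R)$. -/

import Mathlib

universe u v

namespace MomentAngle

open CategoryTheory Opposite Topology

section SimplicialCohomology

variable (R : Type v) [CommRing R]

/-- Cochains of degree `n` of a simplicial set, with coefficients in `R`. -/
abbrev Cochain (S : SSet.{u}) (n : ℕ) : Type (max u v) := S.obj (op (SimplexCategory.mk n)) → R

/-- The coboundary `(δ f)(σ) = ∑ i, (-1)^i f(d_i σ)`. -/
def coboundary (S : SSet.{u}) (n : ℕ) : Cochain R S n →ₗ[R] Cochain R S (n + 1) where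
  toFun f σ := ∑ i : Fin (n + 2), (-1 : R) ^ (i : ℕ) * f (S.δ i σ)
  map_add' f g := by
    funext σ
    simp [mul_add, Finset.sum_add_distrib]
  map_smul' r f := by
    funext σ
    simp only [Pi.smul_apply, smul_eq_mul, RingHom.id_apply, Finset.mul_sum]
    exact Finset.sum_congr rfl fun i _ ↦ by ring

/-- The module of cocycles. -/
def cocycles (S : SSet.{u}) (n : ℕ) : Submodule R (Cochain R S n) :=
  LinearMap.ker (coboundary R S n)

/-- The module of coboundaries; it is zero in degree `0`. -/
def coboundaries (S : SSet.{u}) : (n : ℕ) → Submodule R (Cochain R S n)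
  | 0 => ⊥
  | n + 1 => LinearMap.range (coboundary R S n)

/-- The cohomology of a simplicial set: cocycles modulo coboundaries. -/
abbrev SCohomology (S : SSet.{u}) (n : ℕ) : Type (max u v) :=
  cocycles R S n ⧸ (coboundaries R S n).submoduleOf (cocycles R S n)

/-- The map induced on cochains by a map of simplicial sets. -/
def cochainMap {S T : SSet.{u}} (φ : S ⟶ T) (n : ℕ) : Cochain R T n →ₗ[R] Cochain R S n where
  toFun f σ := f (φ.app _ σ)
  map_add' _ _ := rfl
  map_smul' _ _ := rfl

lemma coboundary_cochainMap {S T : SSet.{u}} (φ : S ⟶ T) (n : ℕ) (f : Cochain R T n) :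
    coboundary R S n (cochainMap R φ n f) = cochainMap R φ (n + 1) (coboundary R T n f) := by
  funext σ
  simp only [coboundary, cochainMap, LinearMap.coe_mk, AddHom.coe_mk]
  refine Finset.sum_congr rfl fun i _ ↦ ?_
  exact congrArg (fun τ ↦ (-1 : R) ^ (i : ℕ) * f τ)
    (ConcreteCategory.congr_hom (φ.naturality (SimplexCategory.δ i).op) σ)

lemma cochainMap_mem_cocycles {S T : SSet.{u}} (φ : S ⟶ T) (n : ℕ) (f : Cochain R T n)
    (hf : f ∈ cocycles R T n) : cochainMap R φ n f ∈ cocycles R S n := by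
  rw [cocycles, LinearMap.mem_ker] at hf ⊢
  rw [coboundary_cochainMap, hf, map_zero]

lemma cochainMap_mem_coboundaries {S T : SSet.{u}} (φ : S ⟶ T) (n : ℕ) (f : Cochain R T n)
    (hf : f ∈ coboundaries R T n) : cochainMap R φ n f ∈ coboundaries R S n := by
  cases n with
  | zero =>
    have h0 : f = 0 := hf
    simp only [h0, map_zero, Submodule.zero_mem]
  | succ k =>
    obtain ⟨g, rfl⟩ := hf
    exact ⟨cochainMap R φ k g, coboundary_cochainMap R φ k g⟩

/-- The map induced on cocycles. -/
def cocycleMap {S T : SSet.{u}} (φ : S ⟶ T) (n : ℕ) : cocycles R T n →ₗ[R] cocycles R S n :=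
  (cochainMap R φ n).restrict (cochainMap_mem_cocycles R φ n)

/-- The map induced on cohomology. -/
def sCohomologyMap {S T : SSet.{u}} (φ : S ⟶ T) (n : ℕ) :
    SCohomology R T n →ₗ[R] SCohomology R S n :=
  Submodule.mapQ _ _ (cocycleMap R φ n)
    fun f hf ↦ cochainMap_mem_coboundaries R φ n f.1 hf

variable {R}

/-- The inclusion of the front face, spanned by the vertices `0, …, p` of `Δⁿ`. -/
def front {p n : ℕ} (h : p ≤ n) : SimplexCategory.mk p ⟶ SimplexCategory.mk n :=
  SimplexCategory.mkHom ⟨fun i ↦ ⟨i, by omega⟩, fun _ _ hij ↦ hij⟩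

/-- The inclusion of the back face, spanned by the vertices `p, …, p + q` of `Δⁿ`, `p + q = n`. -/
def back (p : ℕ) {q n : ℕ} (h : p + q = n) : SimplexCategory.mk q ⟶ SimplexCategory.mk n :=
  SimplexCategory.mkHom ⟨fun i ↦ ⟨p + i, by omega⟩, fun i j hij ↦ by
    exact Nat.add_le_add_left hij p⟩

/-- The cup product of cochains,
`(f ⌣ g)(σ) = f(front p-face of σ) * g(back q-face of σ)`, where `n = p + q`. -/
def cupCochain (S : SSet.{u}) {p q n : ℕ} (h : p + q = n) (f : Cochain R S p)
    (g : Cochain R S q) : Cochain R S n :=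
  fun σ ↦ f (S.map (front (by omega)).op σ) * g (S.map (back p h).op σ)

private lemma smap_comp (S : SSet.{u}) {a b b' c : ℕ}
    (f : SimplexCategory.mk a ⟶ SimplexCategory.mk b)
    (g : SimplexCategory.mk b ⟶ SimplexCategory.mk c)
    (f' : SimplexCategory.mk a ⟶ SimplexCategory.mk b')
    (g' : SimplexCategory.mk b' ⟶ SimplexCategory.mk c)
    (h : ∀ i : Fin (a + 1), (g (f i) : Fin (c + 1)).val = (g' (f' i) : Fin (c + 1)).val)
    (σ : S.obj (op (SimplexCategory.mk c))) :
    S.map f.op (S.map g.op σ) = S.map f'.op (S.map g'.op σ) := by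
  have e : f ≫ g = f' ≫ g' := by
    ext i
    exact h i
  have e1 := ConcreteCategory.congr_hom (S.map_comp g.op f.op) σ
  have e2 := ConcreteCategory.congr_hom (S.map_comp g'.op f'.op) σ
  rw [← op_comp] at e1 e2
  rw [e] at e1
  exact e1.symm.trans e2

private lemma δ_val {n : ℕ} (i : Fin (n + 2)) (j : Fin (n + 1)) :
    ((SimplexCategory.δ i j : Fin (n + 2)) : ℕ) = if (j : ℕ) < i then (j : ℕ) else j + 1 := by
  change ((Fin.succAbove i j : Fin (n + 2)) : ℕ) = _
  rw [Fin.succAbove]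
  split_ifs with h1 h2 h2 <;> simp_all [Fin.lt_def]

/-- The Leibniz rule. -/
lemma coboundary_cupCochain (S : SSet.{u}) {p q n : ℕ} (h : p + q = n) (f : Cochain R S p)
    (g : Cochain R S q) :
    coboundary R S n (cupCochain S h f g) =
      cupCochain S (by omega) (coboundary R S p f) g +
        (-1 : R) ^ p • cupCochain S (by omega) f (coboundary R S q g) := by
  funext σ
  have e : p + 1 + (q + 1) = n + 2 := by omega
  simp only [coboundary, cupCochain, LinearMap.coe_mk, AddHom.coe_mk, Pi.add_apply,
    Pi.smul_apply, smul_eq_mul]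
  rw [← Fin.sum_congr' _ e, Fin.sum_univ_add, Fin.sum_univ_castSucc (n := p + 1),
    Fin.sum_univ_succ (n := q + 1)]
  have h1 (i : Fin (p + 1)) :
      S.map (front (show p ≤ n by omega)).op (S.δ (Fin.cast e (Fin.castAdd (q + 1) i)) σ) =
        S.δ i.castSucc (S.map (front (show p + 1 ≤ n + 1 by omega)).op σ) := by
    refine smap_comp S _ _ _ _ (fun j ↦ ?_) σ
    rw [δ_val]
    refine Eq.trans ?_ (δ_val i.castSucc j).symm
    rfl
  have h2 (i : Fin (p + 1)) :
      S.map (back p h).op (S.δ (Fin.cast e (Fin.castAdd (q + 1) i)) σ) =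
        S.map (back (p + 1) (show p + 1 + q = n + 1 by omega)).op σ := by
    refine (smap_comp S _ _ (𝟙 _) _ (fun j ↦ ?_) σ).trans
      (ConcreteCategory.congr_hom (S.map_id _) _)
    rw [δ_val]
    change (if p + (j : ℕ) < (i : ℕ) then p + (j : ℕ) else p + j + 1) = p + 1 + j
    have := i.isLt
    split_ifs <;> omega
  have h3 (i : Fin (q + 1)) :
      S.map (front (show p ≤ n by omega)).op (S.δ (Fin.cast e (Fin.natAdd (p + 1) i)) σ) =
        S.map (front (show p ≤ n + 1 by omega)).op σ := by
    refine (smap_comp S _ _ (𝟙 _) _ (fun j ↦ ?_) σ).trans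
      (ConcreteCategory.congr_hom (S.map_id _) _)
    rw [δ_val]
    change (if (j : ℕ) < p + 1 + (i : ℕ) then (j : ℕ) else j + 1) = j
    have := j.isLt
    split_ifs <;> omega
  have h4 (i : Fin (q + 1)) :
      S.map (back p h).op (S.δ (Fin.cast e (Fin.natAdd (p + 1) i)) σ) =
        S.δ i.succ (S.map (back p (show p + (q + 1) = n + 1 by omega)).op σ) := by
    refine smap_comp S _ _ _ _ (fun j ↦ ?_) σ
    rw [δ_val]
    change (if p + (j : ℕ) < p + 1 + (i : ℕ) then p + (j : ℕ) else p + j + 1) =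
      p + ((SimplexCategory.δ i.succ j : Fin (q + 2)) : ℕ)
    rw [δ_val, Fin.val_succ]
    split_ifs <;> omega
  have h5 : S.δ (Fin.last (p + 1)) (S.map (front (show p + 1 ≤ n + 1 by omega)).op σ) =
      S.map (front (show p ≤ n + 1 by omega)).op σ := by
    refine (smap_comp S _ _ (𝟙 _) _ (fun j ↦ ?_) σ).trans
      (ConcreteCategory.congr_hom (S.map_id _) _)
    refine (δ_val (Fin.last (p + 1)) j).trans ?_
    exact if_pos j.isLt
  have h6 : S.δ 0 (S.map (back p (show p + (q + 1) = n + 1 by omega)).op σ) =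
      S.map (back (p + 1) (show p + 1 + q = n + 1 by omega)).op σ := by
    refine (smap_comp S _ _ (𝟙 _) _ (fun j ↦ ?_) σ).trans
      (ConcreteCategory.congr_hom (S.map_id _) _)
    change p + ((SimplexCategory.δ 0 j : Fin (q + 2)) : ℕ) = p + 1 + j
    rw [δ_val, if_neg (by simp)]
    omega
  simp only [h1, h2, h3, h4, h5, h6, Fin.val_cast, Fin.val_castAdd, Fin.val_natAdd,
    Fin.val_castSucc, Fin.val_last, Fin.val_succ, Fin.val_zero, add_mul, mul_add, Finset.mul_sum,
    Finset.sum_mul]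
  have key {a a' b b' l k : R} (ha : a = a') (hl : l + k = 0) (hb : b = b') :
      a + b = a' + l + (k + b') := by
    linear_combination ha - hl + hb
  refine key ?_ (by ring) ?_
  · exact Finset.sum_congr rfl fun i _ ↦ by ring
  · exact Finset.sum_congr rfl fun i _ ↦ by ring

lemma cupCochain_mem_cocycles (S : SSet.{u}) {p q n : ℕ} (h : p + q = n) {f : Cochain R S p}
    {g : Cochain R S q} (hf : f ∈ cocycles R S p) (hg : g ∈ cocycles R S q) :
    cupCochain S h f g ∈ cocycles R S n := by
  rw [cocycles, LinearMap.mem_ker] at *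
  rw [coboundary_cupCochain, hf, hg]
  funext σ
  simp [cupCochain]

lemma cupCochain_mem_left (S : SSet.{u}) {p q n : ℕ} (h : p + q = n) {f : Cochain R S p}
    {g : Cochain R S q} (hf : f ∈ coboundaries R S p) (hg : g ∈ cocycles R S q) :
    cupCochain S h f g ∈ coboundaries R S n := by
  cases p with
  | zero =>
    have h0 : f = 0 := hf
    have h1 : cupCochain S h f g = 0 := by
      funext σ
      simp [cupCochain, h0]
    rw [h1]
    exact Submodule.zero_mem _
  | succ k =>
    obtain ⟨n, rfl⟩ : ∃ n', n = n' + 1 := ⟨k + q, by omega⟩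
    obtain ⟨f, rfl⟩ := hf
    refine ⟨cupCochain S (by omega) f g, ?_⟩
    rw [cocycles, LinearMap.mem_ker] at hg
    rw [coboundary_cupCochain, hg]
    funext σ
    simp [cupCochain]

lemma cupCochain_mem_right (S : SSet.{u}) {p q n : ℕ} (h : p + q = n) {f : Cochain R S p}
    {g : Cochain R S q} (hf : f ∈ cocycles R S p) (hg : g ∈ coboundaries R S q) :
    cupCochain S h f g ∈ coboundaries R S n := by
  cases q with
  | zero =>
    have h0 : g = 0 := hg
    have h1 : cupCochain S h f g = 0 := by
      funext σ
      simp [cupCochain, h0]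
    rw [h1]
    exact Submodule.zero_mem _
  | succ k =>
    obtain ⟨n, rfl⟩ : ∃ n', n = n' + 1 := ⟨p + k, by omega⟩
    obtain ⟨g, rfl⟩ := hg
    refine ⟨(-1 : R) ^ p • cupCochain S (by omega) f g, ?_⟩
    rw [cocycles, LinearMap.mem_ker] at hf
    rw [map_smul, coboundary_cupCochain, hf]
    funext σ
    simp [cupCochain, ← mul_assoc, ← mul_pow]

variable (R) in
/-- The cup product of two cocycles, as a cohomology class. -/
def cupCocycle (S : SSet.{u}) {p q n : ℕ} (h : p + q = n) :
    cocycles R S p →ₗ[R] cocycles R S q →ₗ[R] SCohomology R S n :=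
  (LinearMap.mk₂ R
    (fun f g ↦ (⟨cupCochain S h f.1 g.1, cupCochain_mem_cocycles S h f.2 g.2⟩ : cocycles R S n))
    (fun f f' g ↦ by ext σ; simp [cupCochain, add_mul])
    (fun c f g ↦ by ext σ; simp [cupCochain, mul_assoc])
    (fun f g g' ↦ by ext σ; simp [cupCochain, mul_add])
    (fun c f g ↦ by ext σ; simp [cupCochain, mul_left_comm])).compr₂ (Submodule.mkQ _)

variable (R) in
/-- The cup product on cohomology, induced by the cup product of cocycles. -/
def sCup (S : SSet.{u}) {p q n : ℕ} (h : p + q = n) :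
    SCohomology R S p →ₗ[R] SCohomology R S q →ₗ[R] SCohomology R S n :=
  (Submodule.liftQ _ (Submodule.liftQ _ (cupCocycle R S h) (fun f hf ↦ by
      rw [LinearMap.mem_ker]
      ext g
      exact (Submodule.Quotient.mk_eq_zero _).2 (cupCochain_mem_left S h hf g.2))).flip
    (fun g hg ↦ by
      rw [LinearMap.mem_ker]
      refine Submodule.linearMap_qext _ ?_
      ext f
      exact (Submodule.Quotient.mk_eq_zero _).2 (cupCochain_mem_right S h f.2 hg))).flip

lemma sCup_mk (S : SSet.{u}) {p q n : ℕ} (h : p + q = n) (f : cocycles R S p)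
    (g : cocycles R S q) :
    sCup R S h (Submodule.Quotient.mk f) (Submodule.Quotient.mk g) = Submodule.Quotient.mk
      ⟨cupCochain S h f.1 g.1, cupCochain_mem_cocycles S h f.2 g.2⟩ := rfl

end SimplicialCohomology

section SingularCohomology

variable (R : Type v) [CommRing R]

/-- The singular cohomology module `Hⁿ(Y; R)` of a topological space. -/
abbrev SingularCohomology (n : ℕ) (Y : Type u) [TopologicalSpace Y] : Type (max u v) :=
  SCohomology R (TopCat.toSSet.obj (TopCat.of Y)) n

variable {Y Z : Type u} [TopologicalSpace Y] [TopologicalSpace Z]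

/-- The map `f^*` induced by a continuous map on singular cohomology. -/
noncomputable def pullback (n : ℕ) (f : C(Y, Z)) : SingularCohomology R n Z →ₗ[R] SingularCohomology R n Y :=
  sCohomologyMap R (TopCat.toSSet.map (TopCat.ofHom f)) n

/-- The reduced singular cohomology of the pointed space `(Y, y)`: the classes whose restriction
to the base point is zero. -/
noncomputable def reducedCohomology (n : ℕ) (y : Y) : Submodule R (SingularCohomology R n Y) :=
  LinearMap.ker (pullback R n (ContinuousMap.const PUnit.{u + 1} y))

variable {R}

/-- The cup product in singular cohomology. -/
noncomputable def cup {p q n : ℕ} (h : p + q = n) (u : SingularCohomology R p Y)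
    (v : SingularCohomology R q Y) : SingularCohomology R n Y :=
  sCup R (TopCat.toSSet.obj (TopCat.of Y)) h u v

end SingularCohomology

section Spaces

/-- The space `Y` with its compactly generated topology: a set is open if its preimages under all
continuous maps from compact Hausdorff spaces to `Y` are open. -/
abbrev CG (Y : Type u) [TopologicalSpace Y] : Type u :=
  WithGeneratedByTopology (fun K : CompHaus.{u} ↦ K.toTop) Y

/-- The class of compactly generated spaces. -/
abbrev IsCG (Y : Type u) [TopologicalSpace Y] : Prop :=
  IsGeneratedBy (fun K : CompHaus.{u} ↦ K.toTop) Y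

/-- The point of `CG Y` given by a point of `Y`. -/
abbrev CG.of {Y : Type u} [TopologicalSpace Y] (y : Y) : CG Y :=
  WithGeneratedByTopology.equiv.symm y

/-- The point of `Y` underlying a point of `CG Y`. -/
abbrev CG.val {Y : Type u} [TopologicalSpace Y] (y : CG Y) : Y :=
  WithGeneratedByTopology.equiv y

lemma CG.continuous_val {Y : Type u} [TopologicalSpace Y] :
    Continuous (CG.val : CG Y → Y) :=
  WithGeneratedByTopology.continuous_equiv

lemma CG.continuous_of_comp {Y Z : Type u} [TopologicalSpace Y] [TopologicalSpace Z] [IsCG Z]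
    {f : Z → Y} (hf : Continuous f) : Continuous (fun z ↦ CG.of (f z)) :=
  (IsGeneratedBy.equiv_symm_comp_continuous_iff _ f).2 hf

lemma IsCG.of_isClosed {Y : Type u} [TopologicalSpace Y] [IsCG Y] {F : Set Y} (hF : IsClosed F) :
    IsCG F := by
  have (K : CompHaus.{u}) (C : TopologicalSpace.Closeds K.toTop) :
      IsGeneratedBy (fun K : CompHaus.{u} ↦ K.toTop) C := by
    have : CompactSpace C := isCompact_iff_compactSpace.1 C.isClosed.isCompact
    exact inferInstanceAs
      (IsGeneratedBy (fun K : CompHaus.{u} ↦ K.toTop) (CompHaus.of C).toTop)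
  exact hF.isGeneratedBy

variable {Y : Type u}

/-- The relation identifying all points of `S` with each other. -/
def collapseSetoid (S : Set Y) : Setoid Y where
  r a b := a = b ∨ (a ∈ S ∧ b ∈ S)
  iseqv :=
    { refl := fun _ ↦ Or.inl rfl
      symm := by
        rintro a b (rfl | ⟨h, h'⟩)
        exacts [Or.inl rfl, Or.inr ⟨h', h⟩]
      trans := by
        rintro a b c (rfl | ⟨h, h'⟩) (rfl | ⟨k, k'⟩)
        exacts [Or.inl rfl, Or.inr ⟨k, k'⟩, Or.inr ⟨h, h'⟩, Or.inr ⟨h, k'⟩] }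

/-- The quotient space `Y / S`, in which the subset `S` is collapsed to a point. -/
abbrev Collapse (S : Set Y) : Type u := Quotient (collapseSetoid S)

/-- The quotient map `Y → Y / S`. -/
abbrev Collapse.mk (S : Set Y) (y : Y) : Collapse S := Quotient.mk (collapseSetoid S) y

lemma Collapse.mk_eq {S : Set Y} {a b : Y} (ha : a ∈ S) (hb : b ∈ S) :
    Collapse.mk S a = Collapse.mk S b := Quotient.sound (Or.inr ⟨ha, hb⟩)

variable [TopologicalSpace Y]

lemma Collapse.isClosedMap_mk {S : Set Y} (hS : IsClosed S) : IsClosedMap (Collapse.mk S) := by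
  intro C hC
  refine isQuotientMap_quotient_mk'.isClosed_preimage.1 ?_
  by_cases h : (C ∩ S).Nonempty
  · obtain ⟨c, hc, hcS⟩ := h
    convert hC.union hS using 1
    ext y
    constructor
    · rintro ⟨z, hz, hzy⟩
      rcases Quotient.exact hzy with rfl | ⟨-, h2⟩
      exacts [Or.inl hz, Or.inr h2]
    · rintro (hy | hy)
      exacts [⟨y, hy, rfl⟩, ⟨c, hc, Collapse.mk_eq hcS hy⟩]
  · convert hC using 1
    ext y
    constructor
    · rintro ⟨z, hz, hzy⟩
      rcases Quotient.exact hzy with rfl | ⟨h1, -⟩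
      exacts [hz, (h ⟨z, hz, h1⟩).elim]
    · intro hy
      exact ⟨y, hy, rfl⟩

/-- The smash product `Y ∧ Z` of the pointed spaces `(Y, y)` and `(Z, z)`: the quotient of the
compactly generated product by the wedge `Y × {z} ∪ {y} × Z`. -/
abbrev Smash {Y Z : Type u} [TopologicalSpace Y] [TopologicalSpace Z] (y : Y) (z : Z) : Type u :=
  Collapse {w : CG (Y × Z) | w.val.1 = y ∨ w.val.2 = z}

/-- The quotient map `Y × Z → Y ∧ Z`, as a continuous map. -/
def smashProj {Y Z : Type u} [TopologicalSpace Y] [TopologicalSpace Z] (y : Y) (z : Z) :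
    C(CG (Y × Z), Smash y z) :=
  ⟨Collapse.mk _, continuous_quotient_mk'⟩

/-- The base point of the smash product. -/
def smashPt {Y Z : Type u} [TopologicalSpace Y] [TopologicalSpace Z] (y : Y) (z : Z) :
    Smash y z :=
  smashProj y z (CG.of (y, z))

/-- The reduced suspension `ΣY = ([0, 1] × Y) / ({0, 1} × Y ∪ [0, 1] × {y})` of the pointed
space `(Y, y)`. -/
abbrev Susp (y : Y) : Type u :=
  Collapse {w : unitInterval × Y | w.1 = 0 ∨ w.1 = 1 ∨ w.2 = y}

/-- The base point of the reduced suspension. -/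
def suspPt (y : Y) : Susp y := Collapse.mk _ (0, y)

/-- The reduced suspension `Σf : ΣV → ΣU` of a pointed map `f : V → U`. -/
def suspMap {U V : Type u} [TopologicalSpace U] [TopologicalSpace V] {u : U} {v : V}
    (f : C(V, U)) (hf : f v = u) : C(Susp v, Susp u) where
  toFun := Quotient.map (fun w ↦ (w.1, f w.2)) (by
    rintro a b (rfl | ⟨h, h'⟩)
    · exact Or.inl rfl
    · refine Or.inr ⟨h.imp_right (Or.imp_right fun e ↦ ?_), h'.imp_right (Or.imp_right fun e ↦ ?_)⟩
      · exact (congrArg f e).trans hf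
      · exact (congrArg f e).trans hf)
  continuous_toFun := by
    refine continuous_quot_lift _ ?_
    exact continuous_quotient_mk'.comp (by fun_prop)

end Spaces

section Polyhedral

/-- A based CW pair `(X, A, pt)`: a (Hausdorff) CW complex, a subcomplex, and a base point lying
in the subcomplex. -/
structure BasedCWPair where
  /-- The underlying space `X`. -/
  X : Type u
  [top : TopologicalSpace X]
  [t2 : T2Space X]
  [cw : CWComplex (Set.univ : Set X)]
  /-- The subcomplex `A`. -/
  A : RelCWComplex.Subcomplex (Set.univ : Set X)
  /-- The base point. -/
  pt : X
  pt_mem : pt ∈ A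

attribute [instance] BasedCWPair.top BasedCWPair.t2 BasedCWPair.cw

/-- The family of pairs is a suspension pair: `(X i, A i)` is, up to a pointed homeomorphism, a pair
of reduced suspensions `(ΣU, ΣV)`, the inclusion `A i → X i` being the suspension of a pointed map
`f : V → U`. -/
def IsSuspensionPair {m : ℕ} (P : Fin m → BasedCWPair.{u}) : Prop :=
  ∀ i, ∃ (U V : Type u) (_ : TopologicalSpace U) (_ : TopologicalSpace V) (u : U) (v : V)
    (f : C(V, U)) (hf : f v = u) (hX : (P i).X ≃ₜ Susp u) (hA : (P i).A ≃ₜ Susp v),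
    hX (P i).pt = suspPt u ∧ hA ⟨(P i).pt, (P i).pt_mem⟩ = suspPt v ∧
      ∀ a : (P i).A, hX a = suspMap f hf (hA a)

variable {m : ℕ} (K : PreAbstractSimplicialComplex (Fin m)) (P : Fin m → BasedCWPair.{u})
  (I J L : Finset (Fin m))

/-- The product `X^I` of the spaces `X i`, `i ∈ I`, with the compactly generated topology. -/
abbrev CGProd : Type u := CG (∀ i : I, (P i).X)

/-- The fat wedge in `X^I`: some coordinate is the base point. -/
def fatWedge : Set (CGProd P I) := {y | ∃ i : I, y.val i = (P i).pt}

/-- The smash product `X̂^I` of the spaces `X i`, `i ∈ I`. -/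
abbrev BigSmash : Type u := Collapse (fatWedge P I)

/-- The subset `Y^I(σ ∩ I)` of `X^I`: the product of the factors `X i` for `i ∈ σ ∩ I` and `A i` for
`i ∈ I \ σ`. -/
def block (σ : Finset (Fin m)) : Set (CGProd P I) :=
  {y | ∀ i : I, (i : Fin m) ∉ σ → y.val i ∈ (P i).A}

/-- The polyhedral product `Z(K_I) ⊆ X^I`, the union of the `Y^I(σ ∩ I)` over the simplices `σ` of
`K`, the empty simplex included. -/
def polyhedralProduct : Set (CGProd P I) :=
  {y | ∃ σ : Finset (Fin m), (σ ∈ K ∨ σ = ∅) ∧ y ∈ block P I σ}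

/-- The polyhedral smash product `Ẑ(K_I) ⊆ X̂^I`, the union of the `Ŷ^I(σ ∩ I)`, over the simplices
`σ` of `K`, the empty simplex included; `Ŷ^I(σ ∩ I)` is the image of `Y^I(σ ∩ I)`. -/
def smashPolyhedral : Set (BigSmash P I) :=
  ⋃ (σ : Finset (Fin m)) (_ : σ ∈ K ∨ σ = ∅), Collapse.mk (fatWedge P I) '' block P I σ

lemma isClosed_fatWedge : IsClosed (fatWedge P I) := by
  have h : fatWedge P I = ⋃ i : I, CG.val ⁻¹' {y : ∀ i : I, (P i).X | y i = (P i).pt} := by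
    ext y
    simp [fatWedge]
  rw [h]
  exact isClosed_iUnion_of_finite fun i ↦
    (isClosed_eq (continuous_apply i) continuous_const).preimage CG.continuous_val

lemma isClosed_block (σ : Finset (Fin m)) : IsClosed (block P I σ) := by
  have h : block P I σ = CG.val ⁻¹' (⋂ i : I, ⋂ _ : (i : Fin m) ∉ σ,
      {y : ∀ i : I, (P i).X | y i ∈ (P i).A}) := by
    ext y
    simp [block]
  rw [h]
  refine IsClosed.preimage CG.continuous_val (isClosed_iInter fun i ↦ isClosed_iInter fun _ ↦ ?_)
  exact (P i).A.closed'.preimage (continuous_apply i)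

lemma isClosed_polyhedralProduct : IsClosed (polyhedralProduct K P I) := by
  have h : polyhedralProduct K P I =
      ⋃ (σ : Finset (Fin m)) (_ : σ ∈ K ∨ σ = ∅), block P I σ := by
    ext y
    simp only [polyhedralProduct, Set.mem_ofPred_eq, Set.mem_iUnion, exists_prop]
  rw [h]
  exact isClosed_iUnion_of_finite fun σ ↦ isClosed_iUnion_of_finite fun _ ↦ isClosed_block P I σ

lemma smashPolyhedral_eq :
    smashPolyhedral K P I = Collapse.mk (fatWedge P I) '' polyhedralProduct K P I := by
  ext z
  simp only [smashPolyhedral, polyhedralProduct, Set.mem_iUnion, Set.mem_image, Set.mem_ofPred_eq]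
  constructor
  · rintro ⟨σ, hσ, y, hy, rfl⟩
    exact ⟨y, ⟨σ, hσ, hy⟩, rfl⟩
  · rintro ⟨y, ⟨σ, hσ, hy⟩, rfl⟩
    exact ⟨σ, hσ, y, hy, rfl⟩

lemma mk_mem_smashPolyhedral (y : polyhedralProduct K P I) :
    Collapse.mk (fatWedge P I) y.1 ∈ smashPolyhedral K P I := by
  rw [smashPolyhedral_eq]
  exact ⟨y.1, y.2, rfl⟩

/-- The projection `Z(K_I) → Ẑ(K_I)`. -/
def polyhedralProj : C(polyhedralProduct K P I, smashPolyhedral K P I) where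
  toFun y := ⟨Collapse.mk (fatWedge P I) y.1, mk_mem_smashPolyhedral K P I y⟩
  continuous_toFun := (continuous_quotient_mk'.comp continuous_subtype_val).subtype_mk _

lemma isQuotientMap_polyhedralProj : IsQuotientMap (polyhedralProj K P I) := by
  refine IsClosedMap.isQuotientMap ?_ (polyhedralProj K P I).continuous ?_
  · intro C hC
    have h1 : IsClosed (Collapse.mk (fatWedge P I) '' (Subtype.val '' C)) :=
      Collapse.isClosedMap_mk (isClosed_fatWedge P I) _
        ((isClosed_polyhedralProduct K P I).isClosedMap_subtype_val C hC)
    convert h1.preimage (continuous_subtype_val (p := (· ∈ smashPolyhedral K P I))) using 1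
    ext z
    constructor
    · rintro ⟨y, hy, rfl⟩
      exact ⟨y.1, ⟨y, hy, rfl⟩, rfl⟩
    · rintro ⟨_, ⟨y, hy, rfl⟩, hz⟩
      exact ⟨y, hy, Subtype.ext hz⟩
  · rintro ⟨z, hz⟩
    rw [smashPolyhedral_eq] at hz
    obtain ⟨y, hy, rfl⟩ := hz
    exact ⟨⟨y, hy⟩, rfl⟩

/-- The base point of `X^I`, as a point of `Z(K_I)`. -/
def polyhedralPt : polyhedralProduct K P I :=
  ⟨CG.of fun i ↦ (P i).pt, ∅, Or.inr rfl, fun i _ ↦ (P i).pt_mem⟩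

/-- The base point of `Ẑ(K_I)`. -/
def smashPolyhedralPt : smashPolyhedral K P I := polyhedralProj K P I (polyhedralPt K P I)

variable {I J} in
/-- The projection `Z(K_I) → Z(K_J)` for `J ⊆ I`, forgetting the coordinates outside `J`. -/
def polyhedralRestrict (h : J ⊆ I) : C(polyhedralProduct K P I, polyhedralProduct K P J) where
  toFun y := ⟨CG.of fun j ↦ y.1.val ⟨j, h j.2⟩, by
    obtain ⟨σ, hσ, hy⟩ := y.2
    exact ⟨σ, hσ, fun j hj ↦ hy ⟨j, h j.2⟩ hj⟩⟩
  continuous_toFun := by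
    refine Continuous.subtype_mk ?_ _
    have : IsCG (polyhedralProduct K P I) := .of_isClosed (isClosed_polyhedralProduct K P I)
    refine CG.continuous_of_comp ?_
    have h1 : Continuous fun y : polyhedralProduct K P I ↦ y.1.val :=
      CG.continuous_val.comp continuous_subtype_val
    exact continuous_pi fun j ↦ (continuous_apply (⟨j, h j.2⟩ : I)).comp h1

/-- The map `Z(K_{J ∪ L}) → Ẑ(K_J) ∧ Ẑ(K_L)`, `y ↦ [y_J] ∧ [y_L]`. -/
def prePartialDiagonal : C(polyhedralProduct K P (J ∪ L),
    Smash (smashPolyhedralPt K P J) (smashPolyhedralPt K P L)) where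
  toFun y := smashProj _ _ (CG.of
    (polyhedralProj K P J (polyhedralRestrict K P Finset.subset_union_left y),
      polyhedralProj K P L (polyhedralRestrict K P Finset.subset_union_right y)))
  continuous_toFun := by
    have : IsCG (polyhedralProduct K P (J ∪ L)) :=
      .of_isClosed (isClosed_polyhedralProduct K P (J ∪ L))
    exact (smashProj _ _).continuous.comp (CG.continuous_of_comp (by fun_prop))

lemma polyhedralProj_eq_pt {y : polyhedralProduct K P I} (i : I) (hy : y.1.val i = (P i).pt) :
    polyhedralProj K P I y = smashPolyhedralPt K P I :=
  Subtype.ext (Collapse.mk_eq (S := fatWedge P I) ⟨i, hy⟩ ⟨i, rfl⟩)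

lemma prePartialDiagonal_eq_pt {y : polyhedralProduct K P (J ∪ L)}
    (hy : y.1 ∈ fatWedge P (J ∪ L)) : prePartialDiagonal K P J L y = smashPt _ _ := by
  obtain ⟨⟨i, hi⟩, hiy⟩ := hy
  refine Collapse.mk_eq ?_ (Or.inl rfl)
  rcases Finset.mem_union.1 hi with h | h
  · exact Or.inl (polyhedralProj_eq_pt K P J ⟨i, h⟩ hiy)
  · exact Or.inr (polyhedralProj_eq_pt K P L ⟨i, h⟩ hiy)

lemma prePartialDiagonal_factors :
    Function.FactorsThrough (prePartialDiagonal K P J L) (polyhedralProj K P (J ∪ L)) := by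
  intro a b hab
  rcases Quotient.exact (congrArg Subtype.val hab) with h | ⟨ha, hb⟩
  · rw [Subtype.ext h]
  · rw [prePartialDiagonal_eq_pt K P J L ha, prePartialDiagonal_eq_pt K P J L hb]

/-- The partial diagonal `Ẑ(K_I) → Ẑ(K_J) ∧ Ẑ(K_L)`, `I = J ∪ L`. It sends the class of
`y = (y_i)_{i ∈ I}` to `[(y_j)_{j ∈ J}] ∧ [(y_l)_{l ∈ L}]`: the coordinates with index in `J ∩ L`
are duplicated by the reduced diagonals and the factors are then shuffled. -/
noncomputable def partialDiagonal : C(smashPolyhedral K P (J ∪ L),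
    Smash (smashPolyhedralPt K P J) (smashPolyhedralPt K P L)) :=
  (isQuotientMap_polyhedralProj K P (J ∪ L)).lift (prePartialDiagonal K P J L)
    (prePartialDiagonal_factors K P J L)

lemma partialDiagonal_proj (y : polyhedralProduct K P (J ∪ L)) :
    partialDiagonal K P J L (polyhedralProj K P (J ∪ L) y) = smashProj _ _ (CG.of
      (polyhedralProj K P J (polyhedralRestrict K P Finset.subset_union_left y),
        polyhedralProj K P L (polyhedralRestrict K P Finset.subset_union_right y))) :=
  DFunLike.congr_fun ((isQuotientMap_polyhedralProj K P (J ∪ L)).lift_comp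
    (prePartialDiagonal K P J L) (prePartialDiagonal_factors K P J L)) y

end Polyhedral

section StarProduct

variable {R : Type v} [CommRing R]

/-- The cross product `pr₁^* a ⌣ pr₂^* b` in the cohomology of `Y × Z`. -/
noncomputable def cross {Y Z : Type u} [TopologicalSpace Y] [TopologicalSpace Z] {p q : ℕ}
    (a : SingularCohomology R p Y) (b : SingularCohomology R q Z) :
    SingularCohomology R (p + q) (CG (Y × Z)) :=
  cup rfl
    (pullback R p ⟨fun w : CG (Y × Z) ↦ w.val.1, continuous_fst.comp CG.continuous_val⟩ a)
    (pullback R q ⟨fun w : CG (Y × Z) ↦ w.val.2, continuous_snd.comp CG.continuous_val⟩ b)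

/-- `w` is the class `a ⊗ b` in the reduced cohomology of the smash product `Y ∧ Z`: the reduced
class whose pullback to `Y × Z` is the cross product of `a` and `b`. For reduced classes `a`, `b` on
based CW complexes there is exactly one such `w`. -/
def IsSmashCross {Y Z : Type u} [TopologicalSpace Y] [TopologicalSpace Z] {y : Y} {z : Z}
    {p q : ℕ} (a : SingularCohomology R p Y) (b : SingularCohomology R q Z)
    (w : SingularCohomology R (p + q) (Smash y z)) : Prop :=
  w ∈ reducedCohomology R (p + q) (smashPt y z) ∧
    pullback R (p + q) (smashProj y z) w = cross a b

/-- `c` is the `*`-product of `a` and `b`, the class `Δ^*(a ⊗ b)` for the partial diagonal `Δ`. -/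
def IsStarProduct {m : ℕ} (K : PreAbstractSimplicialComplex (Fin m))
    (P : Fin m → BasedCWPair.{u}) (J L : Finset (Fin m)) {p q : ℕ}
    (a : SingularCohomology R p (smashPolyhedral K P J))
    (b : SingularCohomology R q (smashPolyhedral K P L))
    (c : SingularCohomology R (p + q) (smashPolyhedral K P (J ∪ L))) : Prop :=
  ∃ w, IsSmashCross (y := smashPolyhedralPt K P J) (z := smashPolyhedralPt K P L) a b w ∧
    c = pullback R (p + q) (partialDiagonal K P J L) w

end StarProduct
end MomentAngle

namespace MomentAngle

open CategoryTheory Opposite Topology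

section HomotopyInvariance

variable (R : Type v) [CommRing R]

/-- The contravariant functor of `R`-valued functions on a type. -/
noncomputable def functionsFunctor : Type u ⥤ (ModuleCat.{max u v} R)ᵒᵖ where
  obj X := op (ModuleCat.of R (X → R))
  map φ := (ModuleCat.ofHom (LinearMap.funLeft R R φ)).op

variable {R}

/-- The linear map underlying a morphism of `(ModuleCat R)ᵒᵖ` between modules of functions. -/
noncomputable def functionsEval {X Y : Type u} :
    ((functionsFunctor.{u} R).obj X ⟶ (functionsFunctor R).obj Y) →+ ((Y → R) →ₗ[R] X → R) where
  toFun φ := φ.unop.hom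
  map_zero' := rfl
  map_add' _ _ := rfl

/-- The coboundary is the differential of the opposite of the alternating face map complex. -/
lemma functionsEval_d (S : SSet.{u}) (n : ℕ) :
    functionsEval (((AlgebraicTopology.alternatingFaceMapComplex _).obj
      (((SimplicialObject.whiskering _ _).obj (functionsFunctor R)).obj S)).d (n + 1) n) =
      coboundary R S n := by
  rw [AlgebraicTopology.alternatingFaceMapComplex_obj_d]
  refine (map_sum functionsEval _ _).trans (LinearMap.ext fun f ↦ funext fun σ ↦ ?_)
  rw [LinearMap.sum_apply, Finset.sum_apply]
  refine Finset.sum_congr rfl fun i _ ↦ ?_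
  refine (congrArg (fun L : Cochain R S n →ₗ[R] Cochain R S (n + 1) ↦ L f σ)
    (map_zsmul functionsEval ((-1) ^ (i : ℕ)) _)).trans ?_
  rw [LinearMap.smul_apply, Pi.smul_apply, zsmul_eq_mul]
  push_cast
  rfl

lemma sCohomologyMap_eq_of_homotopy {S T : SSet.{u}} {φ ψ : S ⟶ T}
    (H : SimplicialObject.Homotopy φ ψ) (n : ℕ) :
    sCohomologyMap R φ n = sCohomologyMap R ψ n := by
  let h := (H.whiskerRight (functionsFunctor R)).toChainHomotopy
  refine Submodule.linearMap_qext _ (LinearMap.ext fun f ↦ (Submodule.Quotient.eq _).2 ?_)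
  change cochainMap R φ n f.1 - cochainMap R ψ n f.1 ∈ coboundaries R S n
  have hf : coboundary R T n f.1 = 0 := f.2
  cases n with
  | zero =>
    have hc := h.comm 0
    rw [dNext_eq_zero _ _ (by simp), zero_add, prevD_eq h.hom (j' := 1) (w := by simp)] at hc
    have e : cochainMap R φ 0 f.1 =
        functionsEval (h.hom 0 1) (coboundary R T 0 f.1) + cochainMap R ψ 0 f.1 := by
      rw [← functionsEval_d]
      exact congrArg (fun k ↦ functionsEval k f.1) hc
    rw [e, hf, map_zero, zero_add, sub_self]
    exact Submodule.zero_mem _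
  | succ n =>
    have hc := h.comm (n + 1)
    rw [dNext_eq h.hom (i' := n) (w := by simp),
      prevD_eq h.hom (j' := n + 2) (w := by simp)] at hc
    have e : cochainMap R φ _ f.1 = coboundary R S n (functionsEval (h.hom n (n + 1)) f.1) +
        functionsEval (h.hom (n + 1) (n + 2)) (coboundary R T (n + 1) f.1) +
          cochainMap R ψ _ f.1 := by
      rw [← functionsEval_d, ← functionsEval_d]
      exact congrArg (fun k ↦ functionsEval k f.1) hc
    rw [e, hf, map_zero, add_zero, add_sub_cancel_right]
    exact ⟨_, rfl⟩

variable (R)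
variable {Y Z W : Type u} [TopologicalSpace Y] [TopologicalSpace Z] [TopologicalSpace W]

lemma pullback_comp (n : ℕ) (g : C(Z, W)) (f : C(Y, Z)) (w : SingularCohomology R n W) :
    pullback R n (g.comp f) w = pullback R n f (pullback R n g w) := by
  obtain ⟨w, rfl⟩ := Submodule.Quotient.mk_surjective _ w
  rfl

lemma pullback_eq_of_homotopic (n : ℕ) {f g : C(Y, Z)} (h : f.Homotopic g) :
    pullback R n f = pullback R n g := by
  obtain ⟨H⟩ := h
  have H' : TopCat.Homotopy (TopCat.ofHom f) (TopCat.ofHom g) := H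
  exact sCohomologyMap_eq_of_homotopy H'.toSSet.toSimplicialObjectHomotopy n

lemma pullback_eq_zero_of_nullhomotopic (n : ℕ) {f : C(Y, Z)} {z : Z}
    (h : f.Homotopic (ContinuousMap.const Y z)) {w : SingularCohomology R n Z}
    (hw : w ∈ reducedCohomology R n z) : pullback R n f w = 0 := by
  have e : ContinuousMap.const Y z = (ContinuousMap.const PUnit.{u + 1} z).comp
    (ContinuousMap.const Y PUnit.unit) := rfl
  rw [pullback_eq_of_homotopic R n h, e, pullback_comp, LinearMap.mem_ker.1 hw, map_zero]

end HomotopyInvariance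

end MomentAngle

namespace MomentAngle

open Topology unitInterval

section CompactlyGenerated

lemma IsCG.of_compactSpace (C : Type u) [TopologicalSpace C] [CompactSpace C] [T2Space C] :
    IsCG C :=
  inferInstanceAs (IsGeneratedBy (fun K : CompHaus.{u} ↦ K.toTop) (CompHaus.of C).toTop)

/-- The product of the unit interval with a compactly generated space is compactly generated. -/
lemma IsCG.unitInterval_prod (Z : Type u) [TopologicalSpace Z] [IsCG Z] : IsCG (I × Z) := by
  have key {C : Type u} [TopologicalSpace C] [CompactSpace C] [T2Space C] (f : C(C, Z)) :
      Continuous fun w : C × I ↦ CG.of (w.2, f w.1) := by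
    have : IsCG (C × I) := .of_compactSpace _
    exact CG.continuous_of_comp (by fun_prop)
  let F : Z → C(I, CG (I × Z)) := fun z ↦
    ⟨fun t ↦ CG.of (t, z),
      (key (ContinuousMap.const PUnit z)).comp (by fun_prop : Continuous fun t ↦ (PUnit.unit, t))⟩
  have hF : Continuous F := by
    rw [IsGeneratedBy.continuous_iff (X := fun K : CompHaus.{u} ↦ K.toTop)]
    intro C f
    exact ContinuousMap.continuous_of_continuous_uncurry _ (key f)
  exact ⟨(ContinuousMap.continuous_uncurry_of_continuous ⟨F, hF⟩).comp continuous_swap⟩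

end CompactlyGenerated

section Suspension

variable {U V : Type u} [TopologicalSpace U] [TopologicalSpace V] {x : U} {y : V}

/-- The homotopy of maps `ΣU → ΣU` given by a homotopy of maps `(I, ∂I) → (I, ∂I)` applied to the
suspension coordinate. -/
def suspReparam (x : U) (φ : C(I × I, I)) (h₀ : ∀ s, φ (s, 0) = 0) (h₁ : ∀ s, φ (s, 1) = 1) :
    C(I × Susp x, Susp x) where
  toFun w := Quotient.map (fun z ↦ (φ (w.1, z.1), z.2)) (by
    rintro a b (rfl | ⟨ha, hb⟩)
    · exact Or.inl rfl
    · refine Or.inr ⟨?_, ?_⟩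
      · exact ha.imp (fun e ↦ by simp [e, h₀]) (Or.imp_left fun e ↦ by simp [e, h₁])
      · exact hb.imp (fun e ↦ by simp [e, h₀]) (Or.imp_left fun e ↦ by simp [e, h₁])) w.2
  continuous_toFun := by
    refine isQuotientMap_quotient_mk'.continuous_lift_prod_right ?_
    exact continuous_quotient_mk'.comp
      (by fun_prop : Continuous fun p : I × I × U ↦ (φ (p.1, p.2.1), p.2.2))

variable (φ : C(I × I, I)) (h₀ : ∀ s, φ (s, 0) = 0) (h₁ : ∀ s, φ (s, 1) = 1)

lemma suspReparam_mk (s t : I) (z : U) :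
    suspReparam x φ h₀ h₁ (s, Collapse.mk _ (t, z)) = Collapse.mk _ (φ (s, t), z) := rfl

lemma suspReparam_pt (s : I) : suspReparam x φ h₀ h₁ (s, suspPt x) = suspPt x :=
  Collapse.mk_eq (Or.inr (Or.inr rfl)) (Or.inl rfl)

lemma suspReparam_of_eq_self (s : I) (h : ∀ t, φ (s, t) = t) (w : Susp x) :
    suspReparam x φ h₀ h₁ (s, w) = w := by
  induction w using Quotient.inductionOn with
  | h w => rw [suspReparam_mk, h]

lemma suspReparam_suspMap (f : C(V, U)) (hf : f y = x) (s : I) (w : Susp y) :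
    suspReparam x φ h₀ h₁ (s, suspMap f hf w) = suspMap f hf (suspReparam y φ h₀ h₁ (s, w)) := by
  induction w using Quotient.inductionOn with
  | h w => rfl

/-- The homotopy `(s, t) ↦ min (1, (1 + s) t)`, stretching the first half of the interval. -/
noncomputable def stretchLeft : C(I × I, I) :=
  ⟨fun w ↦ Set.projIcc 0 1 zero_le_one ((1 + w.1) * w.2 : ℝ), by fun_prop⟩

/-- The homotopy `(s, t) ↦ max (0, (1 + s) t - s)`, stretching the second half of the interval. -/
noncomputable def stretchRight : C(I × I, I) :=
  ⟨fun w ↦ Set.projIcc 0 1 zero_le_one ((1 + w.1) * w.2 - w.1 : ℝ), by fun_prop⟩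

lemma stretchLeft_zero (s : I) : stretchLeft (s, 0) = 0 := by simp [stretchLeft]

lemma stretchLeft_one (s : I) : stretchLeft (s, 1) = 1 :=
  Set.projIcc_of_right_le zero_le_one (by simp [s.2.1])

lemma stretchLeft_zero_left (t : I) : stretchLeft (0, t) = t := by simp [stretchLeft]

lemma stretchRight_zero (s : I) : stretchRight (s, 0) = 0 :=
  Set.projIcc_of_le_left zero_le_one (by simp [s.2.1])

lemma stretchRight_one (s : I) : stretchRight (s, 1) = 1 := by simp [stretchRight]

lemma stretchRight_zero_left (t : I) : stretchRight (0, t) = t := by simp [stretchRight]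

lemma stretchLeft_eq_one_or_stretchRight_eq_zero (t : I) :
    stretchLeft (1, t) = 1 ∨ stretchRight (1, t) = 0 := by
  rcases le_total (1 / 2 : ℝ) t with h | h
  · exact Or.inl (Set.projIcc_of_right_le zero_le_one (by simp; linarith))
  · exact Or.inr (Set.projIcc_of_le_left zero_le_one (by simp; linarith))

end Suspension

/-- The spaces of a suspension pair carry pointed homotopies `F` and `G`, starting at the identity
and preserving the subcomplexes, such that `(F₁, G₁)` maps into the wedge. -/
lemma IsSuspensionPair.exists_homotopies {m : ℕ} {P : Fin m → BasedCWPair.{u}}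
    (hP : IsSuspensionPair P) (i : Fin m) :
    ∃ F G : C(I × (P i).X, (P i).X),
      ((∀ x, F (0, x) = x) ∧ (∀ s, F (s, (P i).pt) = (P i).pt) ∧
        ∀ s, ∀ x ∈ (P i).A, F (s, x) ∈ (P i).A) ∧
      ((∀ x, G (0, x) = x) ∧ (∀ s, G (s, (P i).pt) = (P i).pt) ∧
        ∀ s, ∀ x ∈ (P i).A, G (s, x) ∈ (P i).A) ∧
      ∀ x, F (1, x) = (P i).pt ∨ G (1, x) = (P i).pt := by
  obtain ⟨U, V, _, _, u, v, f, hf, hX, hA, hpt, -, hfA⟩ := hP i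
  let T (φ : C(I × I, I)) (h₀ : ∀ s, φ (s, 0) = 0) (h₁ : ∀ s, φ (s, 1) = 1) :
      C(I × (P i).X, (P i).X) :=
    ⟨fun w ↦ hX.symm (suspReparam u φ h₀ h₁ (w.1, hX w.2)), by fun_prop⟩
  have hT (φ : C(I × I, I)) (h₀ : ∀ s, φ (s, 0) = 0) (h₁ : ∀ s, φ (s, 1) = 1)
      (h : ∀ t, φ (0, t) = t) :
      (∀ x, T φ h₀ h₁ (0, x) = x) ∧ (∀ s, T φ h₀ h₁ (s, (P i).pt) = (P i).pt) ∧
        ∀ s, ∀ x ∈ (P i).A, T φ h₀ h₁ (s, x) ∈ (P i).A := by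
    refine ⟨fun x ↦ ?_, fun s ↦ ?_, fun s x hx ↦ ?_⟩
    · simp [T, suspReparam_of_eq_self φ h₀ h₁ 0 h]
    · simp only [T, ContinuousMap.coe_mk, hpt, suspReparam_pt]
      rw [← hpt, hX.symm_apply_apply]
    · have e : T φ h₀ h₁ (s, x) = hA.symm (suspReparam v φ h₀ h₁ (s, hA ⟨x, hx⟩)) := by
        refine hX.injective ?_
        rw [hfA, hA.apply_symm_apply, ← suspReparam_suspMap, ← hfA]
        exact hX.apply_symm_apply _
      rw [e]
      exact Subtype.property _
  refine ⟨T stretchLeft stretchLeft_zero stretchLeft_one,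
    T stretchRight stretchRight_zero stretchRight_one, hT _ _ _ stretchLeft_zero_left,
    hT _ _ _ stretchRight_zero_left, fun x ↦ ?_⟩
  obtain ⟨⟨t, z⟩, htz⟩ := Quotient.exists_rep (hX x)
  have hpt' : (P i).pt = hX.symm (suspPt u) := by rw [← hpt, hX.symm_apply_apply]
  simp only [T, ContinuousMap.coe_mk, hpt', hX.symm.injective.eq_iff, ← htz]
  refine (stretchLeft_eq_one_or_stretchRight_eq_zero t).imp (fun e ↦ ?_) fun e ↦ ?_
  · exact Collapse.mk_eq (Or.inr (Or.inl e)) (Or.inl rfl)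
  · exact Collapse.mk_eq (Or.inl e) (Or.inl rfl)

section Deformation

variable {m : ℕ} (K : PreAbstractSimplicialComplex (Fin m)) {P : Fin m → BasedCWPair.{u}}
  (F : ∀ i, C(I × (P i).X, (P i).X)) (hF : ∀ i s, ∀ x ∈ (P i).A, F i (s, x) ∈ (P i).A)
  (J L : Finset (Fin m))

/-- The homotopy of maps `Z(K_J) → Z(K_J)` given by homotopies of maps of pairs on the factors. -/
def polyhedralDeform : C(I × polyhedralProduct K P J, polyhedralProduct K P J) where
  toFun w := ⟨CG.of fun j ↦ F j (w.1, w.2.1.val j), by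
    obtain ⟨τ, hτ, hy⟩ := w.2.2
    exact ⟨τ, hτ, fun j hj ↦ hF _ _ _ (hy j hj)⟩⟩
  continuous_toFun := by
    refine Continuous.subtype_mk ?_ _
    have : IsCG (polyhedralProduct K P J) := .of_isClosed (isClosed_polyhedralProduct K P J)
    have : IsCG (I × polyhedralProduct K P J) := .unitInterval_prod _
    refine CG.continuous_of_comp (continuous_pi fun j ↦ (F j).continuous.comp ?_)
    have h : Continuous fun y : polyhedralProduct K P J ↦ y.1.val :=
      CG.continuous_val.comp continuous_subtype_val
    exact continuous_fst.prodMk ((continuous_apply j).comp (h.comp continuous_snd))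

lemma polyhedralDeform_of_eq_self (s : I) (h : ∀ i x, F i (s, x) = x)
    (y : polyhedralProduct K P J) : polyhedralDeform K F hF J (s, y) = y :=
  Subtype.ext (congrArg CG.of (funext fun j ↦ h j _))

variable {J} in
lemma polyhedralProj_deform_eq_pt {s : I} {y : polyhedralProduct K P J} (j : J)
    (h : F j (s, y.1.val j) = (P j).pt) :
    polyhedralProj K P J (polyhedralDeform K F hF J (s, y)) = smashPolyhedralPt K P J :=
  polyhedralProj_eq_pt K P J j h

variable (G : ∀ i, C(I × (P i).X, (P i).X)) (hG : ∀ i s, ∀ x ∈ (P i).A, G i (s, x) ∈ (P i).A)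

/-- The homotopy `(s, y) ↦ [F_s y_J] ∧ [G_s y_L]` of maps `Z(K_{J ∪ L}) → Ẑ(K_J) ∧ Ẑ(K_L)`. -/
def prePartialDiagonalDeform : C(I × polyhedralProduct K P (J ∪ L),
    Smash (smashPolyhedralPt K P J) (smashPolyhedralPt K P L)) where
  toFun w := smashProj _ _ (CG.of
    (polyhedralProj K P J (polyhedralDeform K F hF J
        (w.1, polyhedralRestrict K P Finset.subset_union_left w.2)),
      polyhedralProj K P L (polyhedralDeform K G hG L
        (w.1, polyhedralRestrict K P Finset.subset_union_right w.2))))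
  continuous_toFun := by
    have : IsCG (polyhedralProduct K P (J ∪ L)) :=
      .of_isClosed (isClosed_polyhedralProduct K P (J ∪ L))
    have : IsCG (I × polyhedralProduct K P (J ∪ L)) := .unitInterval_prod _
    exact (smashProj _ _).continuous.comp (CG.continuous_of_comp (by fun_prop))

variable {J L} in
lemma prePartialDiagonalDeform_eq_pt {s : I} {y : polyhedralProduct K P (J ∪ L)}
    (h : (∃ (j : Fin m) (hj : j ∈ J),
        F j (s, y.1.val ⟨j, Finset.mem_union_left L hj⟩) = (P j).pt) ∨
      ∃ (l : Fin m) (hl : l ∈ L), G l (s, y.1.val ⟨l, Finset.mem_union_right J hl⟩) = (P l).pt) :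
    prePartialDiagonalDeform K F hF J L G hG (s, y) = smashPt _ _ := by
  refine Collapse.mk_eq ?_ (Or.inl rfl)
  rcases h with ⟨j, hj, h⟩ | ⟨l, hl, h⟩
  · exact Or.inl (polyhedralProj_deform_eq_pt K F hF ⟨j, hj⟩ h)
  · exact Or.inr (polyhedralProj_deform_eq_pt K G hG ⟨l, hl⟩ h)

variable {J L} in
lemma prePartialDiagonalDeform_eq_pt_of_mem (hFpt : ∀ i s, F i (s, (P i).pt) = (P i).pt)
    (hGpt : ∀ i s, G i (s, (P i).pt) = (P i).pt) (s : I) {y : polyhedralProduct K P (J ∪ L)}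
    (hy : y.1 ∈ fatWedge P (J ∪ L)) :
    prePartialDiagonalDeform K F hF J L G hG (s, y) = smashPt _ _ := by
  obtain ⟨⟨i, hi⟩, hiy⟩ := hy
  refine prePartialDiagonalDeform_eq_pt K F hF G hG ?_
  rcases Finset.mem_union.1 hi with h | h
  · exact Or.inl ⟨i, h, by rw [hiy, hFpt]⟩
  · exact Or.inr ⟨i, h, by rw [hiy, hGpt]⟩

/-- If the factors carry pointed homotopies `F` and `G` of maps of pairs, starting at the identity,
such that `(F₁, G₁)` maps into the wedge, and `J ∩ L` is nonempty, then the partial diagonal is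
null-homotopic relative to the base point. -/
lemma partialDiagonal_homotopicRel_const (hJL : (J ∩ L).Nonempty)
    (F G : ∀ i, C(I × (P i).X, (P i).X))
    (hF : ∀ i s, ∀ x ∈ (P i).A, F i (s, x) ∈ (P i).A)
    (hG : ∀ i s, ∀ x ∈ (P i).A, G i (s, x) ∈ (P i).A)
    (hFpt : ∀ i s, F i (s, (P i).pt) = (P i).pt) (hGpt : ∀ i s, G i (s, (P i).pt) = (P i).pt)
    (hF0 : ∀ i x, F i (0, x) = x) (hG0 : ∀ i x, G i (0, x) = x)
    (h1 : ∀ i x, F i (1, x) = (P i).pt ∨ G i (1, x) = (P i).pt) :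
    (partialDiagonal K P J L).HomotopicRel (ContinuousMap.const _ (smashPt _ _))
      {smashPolyhedralPt K P (J ∪ L)} := by
  let D := prePartialDiagonalDeform K F hF J L G hG
  have hq := isQuotientMap_polyhedralProj K P (J ∪ L)
  have hfac (s : I) : Function.FactorsThrough (fun y ↦ D (s, y)) (polyhedralProj K P (J ∪ L)) := by
    intro a b hab
    rcases Quotient.exact (congrArg Subtype.val hab) with h | ⟨ha, hb⟩
    · rw [Subtype.ext h]
    · exact (prePartialDiagonalDeform_eq_pt_of_mem K F hF G hG hFpt hGpt s ha).trans
        (prePartialDiagonalDeform_eq_pt_of_mem K F hF G hG hFpt hGpt s hb).symm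
  let H : I × smashPolyhedral K P (J ∪ L) →
      Smash (smashPolyhedralPt K P J) (smashPolyhedralPt K P L) :=
    fun w ↦ D (w.1, Function.surjInv hq.surjective w.2)
  have hH (s : I) (y : polyhedralProduct K P (J ∪ L)) :
      H (s, polyhedralProj K P (J ∪ L) y) = D (s, y) :=
    hfac s (Function.surjInv_eq hq.surjective _)
  refine ⟨⟨⟨⟨H, hq.continuous_lift_prod_right (by simpa only [hH] using D.continuous)⟩,
    fun z ↦ ?_, fun z ↦ ?_⟩, fun s z hz ↦ ?_⟩⟩
  · obtain ⟨y, rfl⟩ := hq.surjective z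
    refine (hH 0 y).trans (Eq.trans ?_ (partialDiagonal_proj K P J L y).symm)
    simp only [D, prePartialDiagonalDeform, ContinuousMap.coe_mk,
      polyhedralDeform_of_eq_self K F hF J 0 hF0, polyhedralDeform_of_eq_self K G hG L 0 hG0]
  · obtain ⟨y, rfl⟩ := hq.surjective z
    obtain ⟨k, hk⟩ := hJL
    obtain ⟨hkJ, hkL⟩ := Finset.mem_inter.1 hk
    exact (hH 1 y).trans (prePartialDiagonalDeform_eq_pt K F hF G hG
      ((h1 k _).imp (fun e ↦ ⟨k, hkJ, e⟩) fun e ↦ ⟨k, hkL, e⟩))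
  · obtain rfl := Set.mem_singleton_iff.1 hz
    obtain ⟨k, hk⟩ := hJL
    have hmem : (polyhedralPt K P (J ∪ L)).1 ∈ fatWedge P (J ∪ L) :=
      ⟨⟨k, Finset.mem_union_left L (Finset.mem_inter.1 hk).1⟩, rfl⟩
    exact ((hH s _).trans
      (prePartialDiagonalDeform_eq_pt_of_mem K F hF G hG hFpt hGpt s hmem)).trans
        ((partialDiagonal_proj K P J L _).trans (prePartialDiagonal_eq_pt K P J L hmem)).symm

end Deformation

end MomentAngle

theorem theorem1p5 {m : ℕ} (K : PreAbstractSimplicialComplex (Fin m))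
    (P : Fin m → MomentAngle.BasedCWPair.{u}) (hP : MomentAngle.IsSuspensionPair P)
    (J L : Finset (Fin m)) (hJL : (J ∩ L).Nonempty) :
    ContinuousMap.HomotopicRel (MomentAngle.partialDiagonal K P J L)
      (ContinuousMap.const _ (MomentAngle.smashPt _ _))
      {MomentAngle.smashPolyhedralPt K P (J ∪ L)} ∧
    ∀ (R : Type v) [CommRing R],
      (∀ (n : ℕ), ∀ w ∈ MomentAngle.reducedCohomology R n
          (MomentAngle.smashPt (MomentAngle.smashPolyhedralPt K P J)
            (MomentAngle.smashPolyhedralPt K P L)),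
        MomentAngle.pullback R n (MomentAngle.partialDiagonal K P J L) w = 0) ∧
      ∀ (p q : ℕ),
        ∀ a ∈ MomentAngle.reducedCohomology R p (MomentAngle.smashPolyhedralPt K P J),
        ∀ b ∈ MomentAngle.reducedCohomology R q (MomentAngle.smashPolyhedralPt K P L),
        ∀ c : MomentAngle.SingularCohomology R (p + q) (MomentAngle.smashPolyhedral K P (J ∪ L)),
          MomentAngle.IsStarProduct K P J L a b c → c = 0 := by
  choose F G hF hG h1 using hP.exists_homotopies
  have h := MomentAngle.partialDiagonal_homotopicRel_const K J L hJL F G (fun i ↦ (hF i).2.2)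
    (fun i ↦ (hG i).2.2) (fun i ↦ (hF i).2.1) (fun i ↦ (hG i).2.1) (fun i ↦ (hF i).1)
    (fun i ↦ (hG i).1) h1
  refine ⟨h, fun R _ ↦ ⟨fun n w hw ↦ ?_, ?_⟩⟩
  · exact MomentAngle.pullback_eq_zero_of_nullhomotopic R n h.homotopic hw
  · rintro p q a - b - c ⟨w, ⟨hw, -⟩, rfl⟩
    exact MomentAngle.pullback_eq_zero_of_nullhomotopic R _ h.homotopic hw
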